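/- Let $\alpha=(\alpha^{ij})$ be a smooth Poisson structure on $\mathbb R^d$. A Kontsevich graph of type $(n,2)$ has aerial vertices $1,\dots,n$ and ground vertices $\bar 1,\bar 2$; each aerial vertex $k$ is the source of exactly two ordered edges $e_k^1=(k,\gamma^1(k))$, $e_k^2=(k,\gamma^2(k))$, with $\gamma^i(k)\ne k$ and $\gamma^1(k)\neq\gamma^2(k)$, and there are no other edges. $G_{n,2}$ is the set of these graphs, $|\Gamma|:=n$, and $\Gamma$ is called connected (a tree) if its restriction to the aerial vertices is connected as an undirected graph (respectively is connected without cycles, a pair of opposite edges counting as a cycle). $T_{n,2}$ is the set of trees. If $e_\Gamma$ is the number of edges landing on ground vertices, the number of loops of a connected graph is $b_\Gamma=n-e_\Gamma+1$; $B^j$ is the set of connected graphs of type $(n,2)$, $n\ge 1$, with $j$ loops. Let $$B_\Gamma(f_1,f_2)=\sum_{I:E_\Gamma\to\{1,\dots,d\}}\Big[\prod_{k=1}^n\Big(\prod_{e=(*,k)}\partial_{I(e)}\Big)\alpha^{I(e_k^1)I(e_k^2)}\Big]\prod_{a=1}^2\Big(\prod_{e=(*,\bar a)}\partial_{I(e)}\Big)f_a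 ,$$ let $\hat B_\Gamma$ be its symbol, a polynomial in $(p_1,p_2)$ with $B_\Gamma(e^{p_1x},e^{p_2x})=\hat B_\Gamma(p_1,p_2,x)e^{(p_1+p_2)x}$, and let $$W_\Gamma=\frac1{(2\pi)^{2n}}\int \bigwedge_{k=1}^n d\psi_k^1\wedge d\psi_k^2$$ be the Kontsevich weight, the integral being over the configurations of $n$ distinct points $z_1,\dots,z_n$ of the upper half plane, where $\psi_k^i=\arg\frac{q-z_k}{q-\bar z_k}$ with $q$ the position of $\gamma^i(k)$ and $\bar1,\bar2$ are placed at $0,1$. Kontsevich's star product of $f,g\in C^\infty(\mathbb R^d)$ is the formal power series $$f*g=fg+\sum_{n\ge1}\frac{h^n}{n!}\sum_{\Gamma\in G_{n,2}}W_\Gamma B_\Gamma(f,g).$$ For $j\ge 0$ put $D^j(p_1,p_2,x)=\sum_{\Gamma\in B^j}\frac{W_\Gamma}{|\Gamma|!}\hat B_\Gamma(p_1,p_2,x)$, a formal power series in $(p_1,p_2)$, and $D=\sum_{j\ge 0}h^jD^j$. Lemma (Exponential formula). For every $x\in\mathbb R^d$, the series $D(hp_1,hp_2,x)$ is divisible by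 $h$, $\frac1hD(hp_1,hp_2,x)$ is a formal power series in $h$ without constant term whose coefficients are polynomials in $(p_1,p_2)$, and for all $f,g\in C^\infty(\mathbb R^d)$ $$f*g(x)=\exp\Big(\frac1hD(h\partial_{x'},h\partial_{x''},x)\Big)f(x')g(x'')\Big|_{x'=x''=x}$$ as formal power series in $h$. (The coefficients at $x$ are not differentiated.) Moreover, the graphs in $B^0$ are exactly the Kontsevich trees of type $(n,2)$, $D^0(hp_1,hp_2,x)$ is divisible by $h$, and the semi-classical part $\frac1hD^0(hp_1,hp_2,x)$ gives the generating function: $$x(p_1+p_2)+\frac1hD^0(hp_1,hp_2,x)=S_h(p_1,p_2,x):=x(p_1+p_2)+\sum_{n\ge1}\frac{h^n}{n!}\sum_{\Gamma\in T_{n,2}}W_\Gamma\hat B_\Gamma(p_1,p_2,x).$$ -/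

import Mathlib

open scoped ContDiff

namespace StarProduct

/-! ### Poisson structures and partial derivatives on `ℝ^d` -/

/-- The partial derivative `∂_i f`. -/
noncomputable def partialDeriv {d : ℕ} (i : Fin d) (f : (Fin d → ℝ) → ℝ) : (Fin d → ℝ) → ℝ :=
  fun x => fderiv ℝ f x (Pi.single i 1)

/-- The multi-index derivative `∂^β f = ∂_0^{β_0} ⋯ ∂_{d-1}^{β_{d-1}} f`. -/
noncomputable def multiDeriv {d : ℕ} (β : Fin d → ℕ) (f : (Fin d → ℝ) → ℝ) :
    (Fin d → ℝ) → ℝ :=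
  (List.finRange d).foldr (fun i F => (partialDeriv i)^[β i] F) f

/-- A (smooth) Poisson structure on `ℝ^d`, given by its components `α^{ij}`. -/
structure PoissonStructure (d : ℕ) where
  /-- the components `α^{ij}(x)` -/
  comp : Fin d → Fin d → (Fin d → ℝ) → ℝ
  smooth : ∀ i j, ContDiff ℝ ∞ (comp i j)
  antisymm : ∀ i j x, comp i j x = - comp j i x
  jacobi : ∀ i j k x, ∑ l,
    (comp i l x * partialDeriv l (comp j k) x + comp j l x * partialDeriv l (comp k i) x
      + comp k l x * partialDeriv l (comp i j) x) = 0

/-! ### Kontsevich graphs -/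

/-- Kontsevich graphs of type `(n, m)`: the aerial vertices are `Sum.inl k`, the ground vertices
are `Sum.inr a`, and `γ k i` is the endpoint of the `i`-th edge starting at the aerial vertex `k`.
There are no small loops and no double edges. -/
def KGraph (n m : ℕ) : Type :=
  {γ : Fin n → Fin 2 → Fin n ⊕ Fin m // (∀ k i, γ k i ≠ Sum.inl k) ∧ ∀ k, γ k 0 ≠ γ k 1}

namespace KGraph

instance (n m : ℕ) : Fintype (KGraph n m) := by
  unfold KGraph; infer_instance

variable {n m : ℕ}

/-- The endpoint of the edge `e = (k, i)`, the `i`-th edge starting at `k`. -/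
def target (Γ : KGraph n m) (e : Fin n × Fin 2) : Fin n ⊕ Fin m := Γ.1 e.1 e.2

/-- The undirected simple graph underlying the restriction of `Γ` to the aerial vertices. -/
def aerialGraph (Γ : KGraph n m) : SimpleGraph (Fin n) where
  Adj k l := k ≠ l ∧ ((∃ i, Γ.1 k i = Sum.inl l) ∨ ∃ i, Γ.1 l i = Sum.inl k)
  symm := ⟨fun _ _ h => ⟨h.1.symm, h.2.symm⟩⟩
  loopless := ⟨fun _ h => h.1 rfl⟩

/-- `Γ` is connected if its restriction to the aerial vertices is. -/
def IsConnected (Γ : KGraph n m) : Prop := Γ.aerialGraph.Connected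

/-- `Γ` is a tree if its restriction to the aerial vertices is connected and has no cycle; a pair
of opposite edges `k → l`, `l → k` counts as a cycle (of length two). -/
def IsTree (Γ : KGraph n m) : Prop :=
  Γ.aerialGraph.IsTree ∧
    ∀ k l, ¬ ((∃ i, Γ.1 k i = Sum.inl l) ∧ ∃ i, Γ.1 l i = Sum.inl k)

/-- The number `e_Γ` of edges landing at ground vertices. -/
def groundEdges (Γ : KGraph n m) : ℕ :=
  (Finset.univ.filter fun e : Fin n × Fin 2 => (Γ.target e).isRight).card

/-- The number of loops `b_Γ = n - e_Γ + 1`. -/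
def loops (Γ : KGraph n m) : ℤ := (n : ℤ) - Γ.groundEdges + 1

/-- For a labelling `I` of the edges by coordinates, the multi-index whose `i`-th entry is the
number of edges with endpoint `v` and label `i`. -/
def inIndex {d : ℕ} (Γ : KGraph n m) (I : Fin n × Fin 2 → Fin d) (v : Fin n ⊕ Fin m) :
    Fin d → ℕ :=
  fun i => (Finset.univ.filter fun e : Fin n × Fin 2 => Γ.target e = v ∧ I e = i).card

/-- The factor `∏_k (∏_{e = (*, k)} ∂_{I(e)}) α^{I(e_k^1) I(e_k^2)}` at the point `x`. -/
noncomputable def aerialCoeff {d : ℕ} (α : PoissonStructure d) (Γ : KGraph n m)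
    (I : Fin n × Fin 2 → Fin d) (x : Fin d → ℝ) : ℝ :=
  ∏ k, multiDeriv (Γ.inIndex I (Sum.inl k)) (α.comp (I (k, 0)) (I (k, 1))) x

/-- The multidifferential operator `B_Γ`. -/
noncomputable def B {d : ℕ} (α : PoissonStructure d) (Γ : KGraph n m)
    (f : Fin m → (Fin d → ℝ) → ℝ) : (Fin d → ℝ) → ℝ :=
  fun x => ∑ I : Fin n × Fin 2 → Fin d,
    Γ.aerialCoeff α I x * ∏ a, multiDeriv (Γ.inIndex I (Sum.inr a)) (f a) x

/-- The symbol `\hat B_Γ(p_1, …, p_m, x)` at the point `x`, as a polynomial in the variables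
`p^a_i = X (a, i)`. It is characterized by `B_exp` below. -/
noncomputable def symbol {d : ℕ} (α : PoissonStructure d) (Γ : KGraph n m) (x : Fin d → ℝ) :
    MvPolynomial (Fin m × Fin d) ℝ :=
  ∑ I : Fin n × Fin 2 → Fin d, MvPolynomial.C (Γ.aerialCoeff α I x) *
    ∏ a, ∏ i, MvPolynomial.X (a, i) ^ Γ.inIndex I (Sum.inr a) i

end KGraph

lemma partialDeriv_iterate_exp {d : ℕ} (p : Fin d → ℝ) (c : ℝ) (i : Fin d) (N : ℕ) :
    (partialDeriv i)^[N] (fun y => c * Real.exp (∑ j, p j * y j)) =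
      fun y => (p i ^ N * c) * Real.exp (∑ j, p j * y j) := by
  induction N with
  | zero => simp
  | succ N ih =>
    rw [Function.iterate_succ_apply', ih]
    funext y
    have h1 : HasFDerivAt (fun y : Fin d → ℝ => ∑ j, p j * y j)
        (∑ j, p j • (ContinuousLinearMap.proj j : (Fin d → ℝ) →L[ℝ] ℝ)) y := by
      apply HasFDerivAt.fun_sum
      intro j _
      exact (hasFDerivAt_apply j y).const_mul (p j)
    have h2 := (h1.exp).const_mul (p i ^ N * c)
    unfold partialDeriv
    rw [h2.fderiv]
    simp [Pi.single_apply]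
    ring

lemma multiDeriv_exp {d : ℕ} (p : Fin d → ℝ) (β : Fin d → ℕ) :
    multiDeriv β (fun y => Real.exp (∑ j, p j * y j)) =
      fun y => (∏ i, p i ^ β i) * Real.exp (∑ j, p j * y j) := by
  have key : ∀ L : List (Fin d),
      L.foldr (fun i F => (partialDeriv i)^[β i] F) (fun y => Real.exp (∑ j, p j * y j)) =
        fun y => (L.map fun i => p i ^ β i).prod * Real.exp (∑ j, p j * y j) := by
    intro L
    induction L with
    | nil => simp
    | cons i L ih =>
      rw [List.foldr_cons, ih, partialDeriv_iterate_exp]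
      simp
  unfold multiDeriv
  rw [key, ← List.ofFn_eq_map, List.prod_ofFn]

/-- `B_Γ(e^{p_1 x}, …, e^{p_m x}) = \hat B_Γ(p_1, …, p_m, x) e^{(p_1 + ⋯ + p_m) x}`. -/
theorem KGraph.B_exp {n m d : ℕ} (α : PoissonStructure d) (Γ : KGraph n m)
    (p : Fin m → Fin d → ℝ) (x : Fin d → ℝ) :
    Γ.B α (fun a y => Real.exp (∑ j, p a j * y j)) x =
      MvPolynomial.eval (fun q => p q.1 q.2) (Γ.symbol α x) *
        Real.exp (∑ j, (∑ a, p a j) * x j) := by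
  have h : ∑ j, (∑ a, p a j) * x j = ∑ a, ∑ j, p a j * x j := by
    rw [Finset.sum_comm]
    simp_rw [Finset.sum_mul]
  rw [h, Real.exp_sum]
  simp only [KGraph.B, KGraph.symbol, multiDeriv_exp, map_sum, map_mul, map_prod, map_pow,
    MvPolynomial.eval_C, MvPolynomial.eval_X, Finset.prod_mul_distrib]
  rw [Finset.sum_mul]
  simp only [mul_assoc]

/-- The symbol is homogeneous of degree `e_Γ` in `(p_1, …, p_m)`. -/
theorem KGraph.symbol_isHomogeneous {n m d : ℕ} (α : PoissonStructure d) (Γ : KGraph n m)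
    (x : Fin d → ℝ) : (Γ.symbol α x).IsHomogeneous Γ.groundEdges := by
  refine MvPolynomial.IsHomogeneous.sum _ _ _ fun I _ => ?_
  have hdeg : Γ.groundEdges = 0 + ∑ a, ∑ i, Γ.inIndex I (Sum.inr a) i := by
    rw [zero_add, ← Fintype.sum_prod_type' (f := fun a i => Γ.inIndex I (Sum.inr a) i)]
    unfold KGraph.groundEdges KGraph.inIndex
    rw [← Finset.card_biUnion]
    · congr 1
      ext e
      rcases he : Γ.target e with k | a
      · simp [he]
      · simp [he]
    · rintro ⟨a, i⟩ _ ⟨b, j⟩ _ hne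
      refine Finset.disjoint_left.2 fun e he he' => hne ?_
      simp only [Finset.mem_filter, Finset.mem_univ, true_and] at he he'
      have h1 := he.1.symm.trans he'.1
      have h2 := he.2.symm.trans he'.2
      simp_all
  rw [hdeg]
  refine (MvPolynomial.isHomogeneous_C _ _).mul ?_
  refine MvPolynomial.IsHomogeneous.prod _ _ _ fun a _ => ?_
  refine MvPolynomial.IsHomogeneous.prod _ _ _ fun i _ => ?_
  simpa using (MvPolynomial.isHomogeneous_X ℝ (a, i)).pow (Γ.inIndex I (Sum.inr a) i)

/-! ### Kontsevich weights -/

/-- `(q - p) / (q - \bar p)`, whose argument is the hyperbolic angle `φ^h(p, q)`. -/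
noncomputable def angleRatio (p q : ℂ) : ℂ := (q - p) / (q - (starRingEnd ℂ) p)

/-- The configurations of `n` distinct points of the upper half plane. -/
def configSpace (n : ℕ) : Set (Fin n → ℂ) :=
  {z | (∀ k, 0 < (z k).im) ∧ Function.Injective z}

namespace KGraph

variable {n : ℕ}

/-- The position of a vertex in the configuration `z`: the ground vertices are at `0` and `1`. -/
noncomputable def position (z : Fin n → ℂ) : Fin n ⊕ Fin 2 → ℂ
  | Sum.inl k => z k
  | Sum.inr a => ((a : ℕ) : ℂ)

/-- `(q - p) / (q - \bar p)` for the edge `e = (p, q)` in the configuration `z`. -/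
noncomputable def edgeRatio (Γ : KGraph n 2) (e : Fin n × Fin 2) (z : Fin n → ℂ) : ℂ :=
  angleRatio (z e.1) (position z (Γ.target e))

/-- The 1-form `dψ_e` at `z`, where `ψ_e = arg u` for `u` the ratio of the edge `e`. As the argument
is only defined up to multiples of `2π`, its differential is written `Im (du / u)`; this is the
differential of every branch, see `fderiv_arg_edgeRatio`. -/
noncomputable def angleForm (Γ : KGraph n 2) (e : Fin n × Fin 2) (z v : Fin n → ℂ) : ℝ :=
  (fderiv ℝ (Γ.edgeRatio e) z v / Γ.edgeRatio e z).im

/-- The real tangent vectors `∂/∂x_k` (for `s = 0`) and `∂/∂y_k` (for `s = 1`). -/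
noncomputable def coordVector (b : Fin n × Fin 2) : Fin n → ℂ :=
  Pi.single b.1 (if b.2 = 0 then 1 else Complex.I)

/-- The density of the top degree form `⋀_k (dψ_k^1 ∧ dψ_k^2)` with respect to
`dx_1 ∧ dy_1 ∧ ⋯ ∧ dx_n ∧ dy_n`. Rows and columns are indexed by the same set, so that the
determinant does not depend on how it is enumerated. -/
noncomputable def weightDensity (Γ : KGraph n 2) (z : Fin n → ℂ) : ℝ :=
  (Matrix.of fun e b : Fin n × Fin 2 => Γ.angleForm e z (coordVector b)).det

/-- The Kontsevich weight `W_Γ`. The boundary strata of the compactified configuration space have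
measure zero, so the integral is taken over its interior. -/
noncomputable def weight (Γ : KGraph n 2) : ℝ :=
  1 / (2 * Real.pi) ^ (2 * n) * ∫ z in configSpace n, Γ.weightDensity z

lemma differentiableAt_edgeRatio (Γ : KGraph n 2) (e : Fin n × Fin 2) {z : Fin n → ℂ}
    (hz : z ∈ configSpace n) : DifferentiableAt ℝ (Γ.edgeRatio e) z := by
  have hpos : DifferentiableAt ℝ (fun z => position z (Γ.target e)) z := by
    rcases Γ.target e with k | a
    · exact differentiableAt_apply (𝕜 := ℝ) k z
    · exact differentiableAt_const _
  have him : 0 ≤ (position z (Γ.target e)).im := by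
    rcases Γ.target e with k | a
    · exact (hz.1 k).le
    · simp [position]
  have hc : DifferentiableAt ℝ (fun z : Fin n → ℂ => (starRingEnd ℂ) (z e.1)) z :=
    Complex.conjCLE.differentiableAt.comp z (differentiableAt_apply (𝕜 := ℝ) e.1 z)
  have hne : position z (Γ.target e) - (starRingEnd ℂ) (z e.1) ≠ 0 := by
    intro h
    have h2 := congrArg Complex.im h
    have h3 := hz.1 e.1
    simp at h2
    linarith
  exact (hpos.fun_sub (differentiableAt_apply (𝕜 := ℝ) e.1 z)).fun_mul
      ((hpos.fun_sub hc).inv hne)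

/-- Off its branch cut, the angle function has differential `angleForm`. -/
theorem fderiv_arg_edgeRatio (Γ : KGraph n 2) (e : Fin n × Fin 2) {z : Fin n → ℂ}
    (hz : z ∈ configSpace n) (hs : Γ.edgeRatio e z ∈ Complex.slitPlane) (v : Fin n → ℂ) :
    fderiv ℝ (fun w => Complex.arg (Γ.edgeRatio e w)) z v = Γ.angleForm e z v := by
  have h1 : HasFDerivAt (fun w => Complex.log (Γ.edgeRatio e w)) _ z :=
    ((Complex.hasStrictFDerivAt_log_real hs).hasFDerivAt).comp z
      (Γ.differentiableAt_edgeRatio e hz).hasFDerivAt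
  have h2 := (Complex.imCLM.hasFDerivAt (x := Complex.log (Γ.edgeRatio e z))).comp z h1
  have h3 : (fun w => Complex.arg (Γ.edgeRatio e w)) =
      Complex.imCLM ∘ fun w => Complex.log (Γ.edgeRatio e w) := by
    funext w
    simp [Complex.log_im]
  rw [h3, h2.fderiv, angleForm]
  simp [div_eq_inv_mul]

end KGraph

/-! ### The star product, and the formal series built from connected graphs -/

/-- Kontsevich's star product
`f * g = f g + ∑_{n ≥ 1} (h^n / n!) ∑_{Γ ∈ G_{n,2}} W_Γ B_Γ(f, g)`, a power series in `h`. -/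
noncomputable def star {d : ℕ} (α : PoissonStructure d) (f g : (Fin d → ℝ) → ℝ) :
    PowerSeries ((Fin d → ℝ) → ℝ) :=
  PowerSeries.mk fun n =>
    if n = 0 then f * g
    else (1 / (n.factorial : ℝ)) • ∑ Γ : KGraph n 2, Γ.weight • Γ.B α ![f, g]

/-- The variables `(p_1, p_2)`, with `p^a_i = X (a, i)`. -/
abbrev PVar (d : ℕ) : Type := Fin 2 × Fin d

/-- `B^j`, the set of connected Kontsevich graphs of type `(n, 2)`, `n ≥ 1`, with `j` loops. -/
def loopGraphs (j : ℕ) : Set (Σ n : ℕ, KGraph n 2) :=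
  {Γ | 1 ≤ Γ.1 ∧ Γ.2.IsConnected ∧ Γ.2.loops = j}

/-- `D^j(p_1, p_2, x) = ∑_{Γ ∈ B^j} (W_Γ / |Γ|!) \hat B_Γ(p_1, p_2, x)`, a formal power series in
`(p_1, p_2)` at the point `x`. The sum is infinite but locally finite, see `finite_loopGraphs`. -/
noncomputable def loopSeries {d : ℕ} (α : PoissonStructure d) (x : Fin d → ℝ) (j : ℕ) :
    MvPowerSeries (PVar d) ℝ :=
  fun β => ∑ᶠ Γ ∈ loopGraphs j,
    Γ.2.weight / (Γ.1.factorial : ℝ) * MvPolynomial.coeff β (Γ.2.symbol α x)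

/-- Only finitely many graphs contribute to a given coefficient of `D^j`. -/
theorem finite_loopGraphs {d : ℕ} (α : PoissonStructure d) (x : Fin d → ℝ) (j : ℕ)
    (β : PVar d →₀ ℕ) :
    {Γ ∈ loopGraphs j | MvPolynomial.coeff β (Γ.2.symbol α x) ≠ 0}.Finite := by
  have hfin : (Set.range fun s : Σ n : Fin (β.degree + j + 1), KGraph n 2 =>
      (⟨s.1, s.2⟩ : Σ n : ℕ, KGraph n 2)).Finite := Set.finite_range _
  refine hfin.subset ?_
  rintro ⟨n, Γ⟩ ⟨⟨_, _, hl⟩, hc⟩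
  have hdeg : β.degree = Γ.groundEdges := by
    have := Γ.symbol_isHomogeneous α x hc
    rw [← this, Finsupp.degree_eq_weight_one]
    rfl
  have hn : n < β.degree + j + 1 := by
    simp only [KGraph.loops] at hl
    omega
  exact ⟨⟨⟨n, hn⟩, Γ⟩, rfl⟩

/-- `D(p_1, p_2, x) = ∑_j h^j D^j(p_1, p_2, x)`. -/
noncomputable def fullSeries {d : ℕ} (α : PoissonStructure d) (x : Fin d → ℝ) :
    PowerSeries (MvPowerSeries (PVar d) ℝ) :=
  PowerSeries.mk (loopSeries α x)

/-- The substitution `F(p_1, p_2) ↦ F(h p_1, h p_2)` for `F = ∑_j h^j F_j` a power series in `h` and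
`(p_1, p_2)`: the part of `F_j` of degree `k` in `(p_1, p_2)` contributes to `h^{j+k}`. The
coefficients of the result are polynomials. -/
noncomputable def hScale {d : ℕ} (F : PowerSeries (MvPowerSeries (PVar d) ℝ)) :
    PowerSeries (MvPolynomial (PVar d) ℝ) :=
  PowerSeries.mk fun N => ∑ jk ∈ Finset.HasAntidiagonal.antidiagonal N,
    MvPolynomial.homogeneousComponent jk.2
      (MvPowerSeries.truncTotal (jk.2 + 1) (PowerSeries.coeff jk.1 F))

/-- Division by `h`, of a power series in `h` that is divisible by `h`. -/
noncomputable def divByH {R : Type*} [Semiring R] (F : PowerSeries R) : PowerSeries R :=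
  PowerSeries.mk fun N => PowerSeries.coeff (N + 1) F

/-- `(1/h) D(h p_1, h p_2, x)`. -/
noncomputable def exponent {d : ℕ} (α : PoissonStructure d) (x : Fin d → ℝ) :
    PowerSeries (MvPolynomial (PVar d) ℝ) :=
  divByH (hScale (fullSeries α x))

/-- The semi-classical part `(1/h) D^0(h p_1, h p_2, x)`. -/
noncomputable def semiclassicalPart {d : ℕ} (α : PoissonStructure d) (x : Fin d → ℝ) :
    PowerSeries (MvPolynomial (PVar d) ℝ) :=
  divByH (hScale (PowerSeries.C (loopSeries α x 0)))

/-- The exponential of a power series in `h` without constant term. -/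
noncomputable def expSeries {d : ℕ} (E : PowerSeries (MvPolynomial (PVar d) ℝ)) :
    PowerSeries (MvPolynomial (PVar d) ℝ) :=
  PowerSeries.subst E (PowerSeries.exp ℝ)

/-- `Q(∂_{x'}, ∂_{x''}) f(x') g(x'') |_{x' = x'' = x}`: a monomial `p_1^β p_2^γ` acts by
`∂^β f(x) ∂^γ g(x)`. -/
noncomputable def applySymbol {d : ℕ} (Q : MvPolynomial (PVar d) ℝ) (f g : (Fin d → ℝ) → ℝ)
    (x : Fin d → ℝ) : ℝ :=
  ∑ β ∈ Q.support, MvPolynomial.coeff β Q *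
    (multiDeriv (fun i => β (0, i)) f x * multiDeriv (fun i => β (1, i)) g x)

/-- `applySymbol`, coefficientwise in `h`. -/
noncomputable def applySeries {d : ℕ} (Q : PowerSeries (MvPolynomial (PVar d) ℝ))
    (f g : (Fin d → ℝ) → ℝ) (x : Fin d → ℝ) : PowerSeries ℝ :=
  PowerSeries.mk fun N => applySymbol (PowerSeries.coeff N Q) f g x

/-- The trivial generating function `S_0 = x (p_1 + p_2)`. -/
noncomputable def trivialGeneratingFunction {d : ℕ} (x : Fin d → ℝ) :
    MvPolynomial (PVar d) ℝ :=
  ∑ i, MvPolynomial.C (x i) * (MvPolynomial.X (0, i) + MvPolynomial.X (1, i))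

open Classical in
/-- The generating function of the formal symplectic groupoid,
`S_h(p_1, p_2, x) = x (p_1 + p_2) + ∑_{n ≥ 1} (h^n / n!) ∑_{Γ ∈ T_{n,2}} W_Γ \hat B_Γ(p_1, p_2, x)`,
the sum being over Kontsevich trees. -/
noncomputable def generatingFunction {d : ℕ} (α : PoissonStructure d) (x : Fin d → ℝ) :
    PowerSeries (MvPolynomial (PVar d) ℝ) :=
  PowerSeries.mk fun n =>
    if n = 0 then trivialGeneratingFunction x
    else (1 / (n.factorial : ℝ)) •
      ∑ Γ : KGraph n 2 with Γ.IsTree, Γ.weight • Γ.symbol α x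

end StarProduct

/-!
The weight and the symbol of a graph are both multiplicative on disjoint unions: the angle of an
edge depends on the positions of its two endpoints only, so the matrix of the angle forms is block
diagonal, and almost every pair of configurations is a configuration of the union.

Let `G_n` and `C_n` be the sums of `W_Γ \hat B_Γ` over all and over the connected graphs of type
`(n, 2)`. Splitting off the connected component of one aerial vertex gives
`G_{n+1} = ∑_k (n choose k) C_{k+1} G_{n-k}`. In terms of exponential generating functions this is
the differential equation `G' = C' G`, whose solution with `G_0 = 1` and `C_0 = 0` is `G = exp C`.

The exponential generating function of `C` is `(1/h) D(h p_1, h p_2, x)`: a connected graph with `n`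
aerial vertices contributes `h^{b_Γ}` times a symbol homogeneous of degree `e_Γ`, and
`b_Γ + e_Γ = n + 1`. Moreover `b_Γ` is the number of edges between aerial vertices, minus `n`,
plus `1`, so by the Euler characteristic a connected graph is a tree exactly when `b_Γ = 0`.
-/

namespace StarProduct

open Finset in
lemma sum_powerset_insert_mem_card {V M : Type*} [DecidableEq V] [AddCommMonoid M] {s : Finset V}
    {v : V} (hv : v ∉ s) (g : ℕ → M) :
    ∑ t ∈ (insert v s).powerset with v ∈ t, g t.card =
      ∑ k ∈ range (s.card + 1), s.card.choose k • g (k + 1) := by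
  have hsub : ∀ t ∈ s.powerset, v ∉ t := fun t ht hvt => hv (mem_powerset.1 ht hvt)
  rw [sum_filter, sum_powerset_insert hv, sum_eq_zero fun t ht => if_neg (hsub t ht), zero_add,
    ← sum_powerset_apply_card fun k => g (k + 1)]
  refine sum_congr rfl fun t ht => ?_
  rw [if_pos (mem_insert_self v t), card_insert_of_notMem (hsub t ht)]

section ExpGenFun

open Finset PowerSeries

variable {R : Type*} [CommRing R]

lemma subst_map_algebraMap {S : Type*} [CommRing S] [Algebra S R] {E : R⟦X⟧} (hE : HasSubst E)
    (f : S⟦X⟧) : subst E (map (algebraMap S R) f) = subst E f := by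
  rw [map_algebraMap_eq_subst_X, subst_comp_subst_apply HasSubst.X' hE, subst_X hE]

lemma derivative_subst_of_algebra {S : Type*} [CommRing S] [Algebra S R] {E : R⟦X⟧}
    (hE : HasSubst E) (f : S⟦X⟧) :
    d⁄dX R (subst E f) = subst E (d⁄dX S f) * d⁄dX R E := by
  have hmap : d⁄dX R (map (algebraMap S R) f) = map (algebraMap S R) (d⁄dX S f) := by
    ext n
    simp [coeff_derivative]
  rw [← subst_map_algebraMap hE f, derivative_subst hE, hmap, subst_map_algebraMap hE]

variable (K : Type*) [Field K] [Algebra K R]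

/-- The exponential generating function `∑ c_n h^n / n!` of a sequence `c` in an algebra over a
field `K` (of characteristic zero; otherwise the junk value `1 / 0 = 0` kills coefficients). -/
noncomputable def expGenFun (c : ℕ → R) : R⟦X⟧ :=
  PowerSeries.mk fun n => (1 / (n.factorial : K)) • c n

lemma coeff_expGenFun (c : ℕ → R) (n : ℕ) :
    coeff n (expGenFun K c) = (1 / (n.factorial : K)) • c n :=
  coeff_mk _ _

lemma constantCoeff_expGenFun (c : ℕ → R) : constantCoeff (expGenFun K c) = c 0 := by
  simp [expGenFun, ← coeff_zero_eq_constantCoeff_apply]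

variable [CharZero K]

lemma constantCoeff_subst_exp {E : R⟦X⟧} (hE : constantCoeff E = 0) :
    constantCoeff (subst E (exp K)) = 1 := by
  rw [← coeff_zero_eq_constantCoeff_apply, coeff_subst' (HasSubst.of_constantCoeff_zero' hE),
    finsum_eq_single _ 0 fun k hk => by simp [hE, hk]]
  simp

variable {K} in
lemma mul_subst_exp_neg_eq_one {E A : R⟦X⟧} (hE : constantCoeff E = 0)
    (hA : constantCoeff A = 1) (h : d⁄dX R A = d⁄dX R E * A) : A * subst (-E) (exp K) = 1 := by
  have hE' : constantCoeff (-E) = 0 := by rw [map_neg, hE, neg_zero]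
  let _ : Module ℚ R := Module.compHom R (algebraMap ℚ K)
  have := IsAddTorsionFree.of_module_rat R
  refine derivative.ext ?_ ?_
  · rw [Derivation.leibniz, derivative_subst_of_algebra (HasSubst.of_constantCoeff_zero' hE'),
      derivative_exp, h, map_neg, Derivation.map_one_eq_zero, smul_eq_mul, smul_eq_mul]
    ring
  · rw [map_mul, hA, constantCoeff_subst_exp K hE', mul_one, map_one]

theorem eq_subst_exp_of_derivative_eq {E A : R⟦X⟧} (hE : constantCoeff E = 0)
    (hA : constantCoeff A = 1) (h : d⁄dX R A = d⁄dX R E * A) : A = subst E (exp K) := by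
  have hexp : d⁄dX R (subst E (exp K)) = d⁄dX R E * subst E (exp K) := by
    rw [derivative_subst_of_algebra (HasSubst.of_constantCoeff_zero' hE), derivative_exp, mul_comm]
  exact left_inv_eq_right_inv (mul_subst_exp_neg_eq_one (K := K) hE hA h) ((mul_comm _ _).trans
    (mul_subst_exp_neg_eq_one hE (constantCoeff_subst_exp K hE) hexp))

lemma derivative_expGenFun (c : ℕ → R) :
    d⁄dX R (expGenFun K c) = expGenFun K fun n => c (n + 1) := by
  ext n
  have hn : (n + 1 : K) ≠ 0 := n.cast_add_one_ne_zero
  have hcast : (n + 1 : R) = algebraMap K R (n + 1) := by simp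
  rw [coeff_derivative, coeff_expGenFun, coeff_expGenFun, hcast, mul_comm, ← Algebra.smul_def,
    smul_smul, Nat.factorial_succ]
  congr 1
  push_cast
  field_simp

lemma expGenFun_mul (a b : ℕ → R) : expGenFun K a * expGenFun K b =
    expGenFun K fun n => ∑ p ∈ antidiagonal n, n.choose p.1 • (a p.1 * b p.2) := by
  ext n
  rw [coeff_mul, coeff_expGenFun, smul_sum]
  refine sum_congr rfl fun p hp => ?_
  obtain rfl := mem_antidiagonal.1 hp
  rw [coeff_expGenFun, coeff_expGenFun, smul_mul_smul_comm, ← Nat.cast_smul_eq_nsmul K, smul_smul,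
    Nat.cast_add_choose]
  congr 1
  have := Nat.factorial_ne_zero (p.1 + p.2)
  field_simp

theorem expGenFun_eq_subst_exp {c g : ℕ → R} (hc : c 0 = 0) (hg : g 0 = 1)
    (h : ∀ n, g (n + 1) = ∑ p ∈ antidiagonal n, n.choose p.1 • (c (p.1 + 1) * g p.2)) :
    expGenFun K g = subst (expGenFun K c) (exp K) := by
  refine eq_subst_exp_of_derivative_eq K ((constantCoeff_expGenFun K c).trans hc)
    ((constantCoeff_expGenFun K g).trans hg) ?_
  rw [derivative_expGenFun, derivative_expGenFun, expGenFun_mul, funext h]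

end ExpGenFun

open SimpleGraph in
lemma reachable_sum_inl_iff {V W : Type*} {G : SimpleGraph V} {H : SimpleGraph W} {v : V}
    {y : V ⊕ W} :
    (G ⊕g H).Reachable (.inl v) y ↔ ∃ w, y = .inl w ∧ G.Reachable v w := by
  constructor
  · intro h
    rw [reachable_iff_reflTransGen] at h
    induction h with
    | refl => exact ⟨v, rfl, Reachable.refl v⟩
    | @tail _ y' _ hadj ih =>
      obtain ⟨w, rfl, hw⟩ := ih
      rcases y' with w' | w'
      · exact ⟨w', rfl, hw.trans (sum_adj_inl.1 hadj).reachable⟩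
      · exact (not_adj_sum_inl_inr _ _ hadj).elim
  · rintro ⟨w, rfl, hw⟩
    exact hw.map Embedding.sumInl.toHom

open MeasureTheory in
lemma ae_injective {ι E : Type*} [Finite ι] [NormedAddCommGroup E] [NormedSpace ℝ E]
    [FiniteDimensional ℝ E] [Nontrivial E] [MeasurableSpace E] [BorelSpace E]
    (μ : Measure (ι → E)) [μ.IsAddHaarMeasure] : ∀ᵐ z ∂μ, Function.Injective z := by
  have := Fintype.ofFinite ι
  have hne : ∀ k l : ι, k ≠ l → ∀ᵐ z ∂μ, z k ≠ z l := fun k l hkl => by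
    classical
    let s : Submodule ℝ (ι → E) := LinearMap.eqLocus (LinearMap.proj k) (LinearMap.proj l)
    have hs : s ≠ ⊤ := fun h => by
      obtain ⟨v, hv⟩ := exists_ne (0 : E)
      have hmem : Pi.single k v ∈ s := h ▸ Submodule.mem_top
      simp [s, hkl.symm, hv] at hmem
    exact measure_mono_null (fun z hz => by simpa [s] using hz) (Measure.addHaar_submodule μ s hs)
  have hall : ∀ᵐ z ∂μ, ∀ k l : ι, k ≠ l → z k ≠ z l := by
    simpa only [ae_all_iff, Filter.eventually_imp_distrib_left] using hne
  filter_upwards [hall] with z hz k l hkl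
  exact by_contra fun h => hz k l h hkl

/-! ### Disjoint unions of graphs -/

section SumMap

variable {A B C D : Type*} {f : A → B} {g : C → D} {t : A ⊕ C}

lemma sumMap_eq_inl_iff {y : B} : Sum.map f g t = Sum.inl y ↔ ∃ x, t = Sum.inl x ∧ f x = y := by
  cases t <;> simp

lemma sumMap_eq_inr_iff {y : D} : Sum.map f g t = Sum.inr y ↔ ∃ x, t = Sum.inr x ∧ g x = y := by
  cases t <;> simp

end SumMap

namespace KGraph

variable {a b n m : ℕ}

/-- The edges of `Γ` starting at the vertices `ι j` are the edges of `Γ₁`, transported along `ι`.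
In particular no edge of `Γ` leaves the range of `ι` towards another aerial vertex. -/
def RestrictsTo (Γ : KGraph n m) (ι : Fin a → Fin n) (Γ₁ : KGraph a m) : Prop :=
  ∀ j i, Γ.1 (ι j) i = Sum.map ι id (Γ₁.1 j i)

lemma RestrictsTo.unique {Γ : KGraph n m} {ι : Fin a → Fin n} (hι : Function.Injective ι)
    {Γ₁ Γ₁' : KGraph a m} (h : Γ.RestrictsTo ι Γ₁) (h' : Γ.RestrictsTo ι Γ₁') : Γ₁ = Γ₁' :=
  Subtype.ext <| funext₂ fun j i =>
    hι.sumMap Function.injective_id ((h j i).symm.trans (h' j i))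

lemma exists_restrictsTo {Γ : KGraph n m} {ι : Fin a → Fin n}
    (h : ∀ j i l, Γ.1 (ι j) i = Sum.inl l → l ∈ Set.range ι) : ∃ Γ₁, Γ.RestrictsTo ι Γ₁ := by
  have hpre : ∀ j i, ∃ t, Γ.1 (ι j) i = Sum.map ι id t := fun j i => by
    rcases ht : Γ.1 (ι j) i with l | c
    · obtain ⟨k, rfl⟩ := h j i l ht
      exact ⟨Sum.inl k, rfl⟩
    · exact ⟨Sum.inr c, rfl⟩
  choose γ hγ using hpre
  exact ⟨⟨γ, fun j i hj => Γ.2.1 (ι j) i (by rw [hγ, hj, Sum.map_inl]),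
    fun j hj => Γ.2.2 (ι j) (by rw [hγ, hγ, hj])⟩, hγ⟩

/-- The disjoint union of two graphs (with common ground vertices), the aerial vertices being
relabelled by `σ`. -/
def glue (σ : Fin a ⊕ Fin b ≃ Fin n) (Γ₁ : KGraph a m) (Γ₂ : KGraph b m) : KGraph n m :=
  ⟨fun k i => Sum.elim (fun j => Sum.map (σ ∘ Sum.inl) id (Γ₁.1 j i))
      (fun j => Sum.map (σ ∘ Sum.inr) id (Γ₂.1 j i)) (σ.symm k), by
    have hl : Function.Injective (Sum.map (σ ∘ Sum.inl) (id : Fin m → Fin m)) :=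
      (σ.injective.comp Sum.inl_injective).sumMap Function.injective_id
    have hr : Function.Injective (Sum.map (σ ∘ Sum.inr) (id : Fin m → Fin m)) :=
      (σ.injective.comp Sum.inr_injective).sumMap Function.injective_id
    constructor <;> refine σ.surjective.forall.2 (Sum.forall.2 ⟨fun j => ?_, fun j => ?_⟩)
    · simpa using fun i h => Γ₁.2.1 j i (hl h)
    · simpa using fun i h => Γ₂.2.1 j i (hr h)
    · simpa using fun h => Γ₁.2.2 j (hl h)
    · simpa using fun h => Γ₂.2.2 j (hr h)⟩

variable (σ : Fin a ⊕ Fin b ≃ Fin n) (Γ₁ : KGraph a m) (Γ₂ : KGraph b m)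

lemma glue_restrictsTo_inl : (glue σ Γ₁ Γ₂).RestrictsTo (σ ∘ Sum.inl) Γ₁ := fun j i => by
  simp [glue]

lemma glue_restrictsTo_inr : (glue σ Γ₁ Γ₂).RestrictsTo (σ ∘ Sum.inr) Γ₂ := fun j i => by
  simp [glue]

variable {σ Γ₁ Γ₂}

lemma eq_glue_iff {Γ : KGraph n m} :
    Γ = glue σ Γ₁ Γ₂ ↔ Γ.RestrictsTo (σ ∘ Sum.inl) Γ₁ ∧ Γ.RestrictsTo (σ ∘ Sum.inr) Γ₂ := by
  refine ⟨fun h => h ▸ ⟨glue_restrictsTo_inl σ Γ₁ Γ₂, glue_restrictsTo_inr σ Γ₁ Γ₂⟩, fun h => ?_⟩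
  refine Subtype.ext <| funext <| σ.surjective.forall.2 <| Sum.forall.2
    ⟨fun j => funext fun i => ?_, fun j => funext fun i => ?_⟩
  · exact (h.1 j i).trans (glue_restrictsTo_inl σ Γ₁ Γ₂ j i).symm
  · exact (h.2 j i).trans (glue_restrictsTo_inr σ Γ₁ Γ₂ j i).symm

lemma glue_inj {Γ₁' : KGraph a m} {Γ₂' : KGraph b m} :
    glue σ Γ₁ Γ₂ = glue σ Γ₁' Γ₂' ↔ Γ₁ = Γ₁' ∧ Γ₂ = Γ₂' := by
  refine ⟨fun h => ?_, fun h => h.1 ▸ h.2 ▸ rfl⟩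
  obtain ⟨h₁, h₂⟩ := eq_glue_iff.1 h
  exact ⟨(glue_restrictsTo_inl σ Γ₁ Γ₂).unique (σ.injective.comp Sum.inl_injective) h₁,
    (glue_restrictsTo_inr σ Γ₁ Γ₂).unique (σ.injective.comp Sum.inr_injective) h₂⟩

lemma exists_eq_glue {Γ : KGraph n m}
    (h : ∀ j k, ¬ Γ.aerialGraph.Adj (σ (Sum.inl j)) (σ (Sum.inr k))) :
    ∃ Γ₁ Γ₂, Γ = glue σ Γ₁ Γ₂ := by
  obtain ⟨Γ₁, h₁⟩ : ∃ Γ₁, Γ.RestrictsTo (σ ∘ Sum.inl) Γ₁ := exists_restrictsTo fun j i l hl => by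
    obtain ⟨k | k, rfl⟩ := σ.surjective l
    · exact ⟨k, rfl⟩
    · exact (h j k ⟨by simp, Or.inl ⟨i, hl⟩⟩).elim
  obtain ⟨Γ₂, h₂⟩ : ∃ Γ₂, Γ.RestrictsTo (σ ∘ Sum.inr) Γ₂ := exists_restrictsTo fun j i l hl => by
    obtain ⟨k | k, rfl⟩ := σ.surjective l
    · exact (h k j ⟨by simp, Or.inr ⟨i, hl⟩⟩).elim
    · exact ⟨k, rfl⟩
  exact ⟨Γ₁, Γ₂, eq_glue_iff.2 ⟨h₁, h₂⟩⟩

variable (σ Γ₁ Γ₂)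

lemma glue_swap : glue ((Equiv.sumComm _ _).trans σ) Γ₂ Γ₁ = glue σ Γ₁ Γ₂ :=
  (eq_glue_iff.2 ⟨glue_restrictsTo_inr σ Γ₁ Γ₂, glue_restrictsTo_inl σ Γ₁ Γ₂⟩).symm

/-- The edges of a disjoint union, as a disjoint union of sets of edges. -/
def edgeEquiv : (Fin a × Fin 2) ⊕ (Fin b × Fin 2) ≃ Fin n × Fin 2 :=
  (Equiv.sumProdDistrib (Fin a) (Fin b) (Fin 2)).symm.trans (σ.prodCongr (Equiv.refl _))

lemma edgeEquiv_inl (e : Fin a × Fin 2) :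
    edgeEquiv σ (Sum.inl e) = ((σ ∘ Sum.inl) e.1, e.2) := rfl

lemma edgeEquiv_inr (e : Fin b × Fin 2) :
    edgeEquiv σ (Sum.inr e) = ((σ ∘ Sum.inr) e.1, e.2) := rfl

variable {d : ℕ} (I : Fin n × Fin 2 → Fin d)

lemma inIndex_glue (v : Fin n ⊕ Fin m) (i : Fin d) :
    (glue σ Γ₁ Γ₂).inIndex I v i =
      (Finset.univ.filter fun e : Fin a × Fin 2 =>
        Sum.map (σ ∘ Sum.inl) id (Γ₁.target e) = v ∧ I (edgeEquiv σ (Sum.inl e)) = i).card +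
      (Finset.univ.filter fun e : Fin b × Fin 2 =>
        Sum.map (σ ∘ Sum.inr) id (Γ₂.target e) = v ∧ I (edgeEquiv σ (Sum.inr e)) = i).card := by
  simp only [inIndex, Finset.card_filter]
  rw [← Equiv.sum_comp (edgeEquiv σ), Fintype.sum_sum_type]
  simp only [target, edgeEquiv_inl, edgeEquiv_inr, glue_restrictsTo_inl σ Γ₁ Γ₂ _ _,
    glue_restrictsTo_inr σ Γ₁ Γ₂ _ _]
  congr!

lemma inIndex_glue_ground (c : Fin m) (i : Fin d) :
    (glue σ Γ₁ Γ₂).inIndex I (Sum.inr c) i =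
      Γ₁.inIndex (I ∘ edgeEquiv σ ∘ Sum.inl) (Sum.inr c) i +
        Γ₂.inIndex (I ∘ edgeEquiv σ ∘ Sum.inr) (Sum.inr c) i := by
  rw [inIndex_glue]
  simp [inIndex, sumMap_eq_inr_iff]

lemma inIndex_glue_inl (j : Fin a) :
    (glue σ Γ₁ Γ₂).inIndex I (Sum.inl (σ (Sum.inl j))) =
      Γ₁.inIndex (I ∘ edgeEquiv σ ∘ Sum.inl) (Sum.inl j) := by
  funext i
  rw [inIndex_glue]
  simp [inIndex, sumMap_eq_inl_iff]

lemma inIndex_glue_inr (j : Fin b) :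
    (glue σ Γ₁ Γ₂).inIndex I (Sum.inl (σ (Sum.inr j))) =
      Γ₂.inIndex (I ∘ edgeEquiv σ ∘ Sum.inr) (Sum.inl j) := by
  rw [← glue_swap]
  exact inIndex_glue_inl _ Γ₂ Γ₁ I j

variable (α : PoissonStructure d) (x : Fin d → ℝ)

lemma aerialCoeff_glue :
    (glue σ Γ₁ Γ₂).aerialCoeff α I x =
      Γ₁.aerialCoeff α (I ∘ edgeEquiv σ ∘ Sum.inl) x *
        Γ₂.aerialCoeff α (I ∘ edgeEquiv σ ∘ Sum.inr) x := by
  unfold aerialCoeff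
  rw [← Equiv.prod_comp σ, Fintype.prod_sum_type]
  simp only [inIndex_glue_inl, inIndex_glue_inr, Function.comp_apply, edgeEquiv_inl, edgeEquiv_inr]

theorem symbol_glue : (glue σ Γ₁ Γ₂).symbol α x = Γ₁.symbol α x * Γ₂.symbol α x := by
  unfold symbol
  rw [Finset.sum_mul_sum, ← Fintype.sum_prod_type']
  refine Fintype.sum_equiv (((edgeEquiv σ).symm.arrowCongr (Equiv.refl _)).trans
    (Equiv.sumArrowEquivProdArrow _ _ _)) _ _ fun I => ?_
  simp only [aerialCoeff_glue, inIndex_glue_ground, pow_add, Finset.prod_mul_distrib, map_mul]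
  exact mul_mul_mul_comm _ _ _ _

lemma symbol_zero (Γ : KGraph 0 m) : Γ.symbol α x = 1 := by
  simp [symbol, aerialCoeff, inIndex]

end KGraph

/-! ### Weights of disjoint unions -/

namespace KGraph

open MeasureTheory

variable {a b n : ℕ}

section Restrict

variable {Γ : KGraph n 2} {Γ₁ : KGraph a 2} {ι : Fin a → Fin n}

lemma RestrictsTo.edgeRatio_eq (h : Γ.RestrictsTo ι Γ₁) (e : Fin a × Fin 2) :
    Γ.edgeRatio (ι e.1, e.2) = Γ₁.edgeRatio e ∘ Pi.compRightL ℝ (fun _ => ℂ) ι := by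
  funext z
  have hpos : position z (Sum.map ι id (Γ₁.1 e.1 e.2)) = position (z ∘ ι) (Γ₁.1 e.1 e.2) := by
    rcases Γ₁.1 e.1 e.2 with k | c <;> rfl
  simp only [edgeRatio, target, h e.1 e.2, hpos, Function.comp_apply]
  rfl

lemma RestrictsTo.angleForm_eq (h : Γ.RestrictsTo ι Γ₁) (e : Fin a × Fin 2) {z : Fin n → ℂ}
    (hz : z ∘ ι ∈ configSpace a) (v : Fin n → ℂ) :
    Γ.angleForm (ι e.1, e.2) z v = Γ₁.angleForm e (z ∘ ι) (v ∘ ι) := by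
  have hderiv : HasFDerivAt (𝕜 := ℝ) (Γ.edgeRatio (ι e.1, e.2))
      ((fderiv ℝ (Γ₁.edgeRatio e) (z ∘ ι)).comp (Pi.compRightL ℝ (fun _ => ℂ) ι)) z := by
    rw [h.edgeRatio_eq]
    exact HasFDerivAt.comp z (Γ₁.differentiableAt_edgeRatio e hz).hasFDerivAt
      (Pi.compRightL ℝ (fun _ => ℂ) ι).hasFDerivAt
  unfold angleForm
  rw [hderiv.fderiv, h.edgeRatio_eq]
  rfl

lemma coordVector_comp (hι : Function.Injective ι) (e : Fin a × Fin 2) :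
    coordVector (ι e.1, e.2) ∘ ι = coordVector e := by
  funext j
  simp [coordVector, Pi.single_apply, hι.eq_iff]

lemma coordVector_comp_of_notMem {e : Fin n × Fin 2} (he : e.1 ∉ Set.range ι) :
    coordVector e ∘ ι = 0 := by
  funext j
  have hj : ι j ≠ e.1 := fun h => he ⟨j, h⟩
  simp [coordVector, hj]

lemma RestrictsTo.angleForm_coordVector (h : Γ.RestrictsTo ι Γ₁) (hι : Function.Injective ι)
    {z : Fin n → ℂ} (hz : z ∘ ι ∈ configSpace a) (e c : Fin a × Fin 2) :
    Γ.angleForm (ι e.1, e.2) z (coordVector (ι c.1, c.2)) =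
      Γ₁.angleForm e (z ∘ ι) (coordVector c) := by
  rw [h.angleForm_eq e hz, coordVector_comp hι]

lemma RestrictsTo.angleForm_coordVector_of_notMem (h : Γ.RestrictsTo ι Γ₁) {z : Fin n → ℂ}
    (hz : z ∘ ι ∈ configSpace a) (e : Fin a × Fin 2) {c : Fin n × Fin 2}
    (hc : c.1 ∉ Set.range ι) : Γ.angleForm (ι e.1, e.2) z (coordVector c) = 0 := by
  rw [h.angleForm_eq e hz, coordVector_comp_of_notMem hc]
  simp [angleForm]

end Restrict

variable (σ : Fin a ⊕ Fin b ≃ Fin n)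

lemma weightDensity_glue (Γ₁ : KGraph a 2) (Γ₂ : KGraph b 2) {z : Fin n → ℂ}
    (h₁ : z ∘ σ ∘ Sum.inl ∈ configSpace a) (h₂ : z ∘ σ ∘ Sum.inr ∈ configSpace b) :
    (glue σ Γ₁ Γ₂).weightDensity z =
      Γ₁.weightDensity (z ∘ σ ∘ Sum.inl) * Γ₂.weightDensity (z ∘ σ ∘ Sum.inr) := by
  have hr₁ := glue_restrictsTo_inl σ Γ₁ Γ₂
  have hr₂ := glue_restrictsTo_inr σ Γ₁ Γ₂
  have hl : Function.Injective (σ ∘ Sum.inl) := σ.injective.comp Sum.inl_injective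
  have hr : Function.Injective (σ ∘ Sum.inr) := σ.injective.comp Sum.inr_injective
  unfold weightDensity
  rw [← Matrix.det_submatrix_equiv_self (edgeEquiv σ),
    ← Matrix.det_fromBlocks_zero₂₁ _ (0 : Matrix (Fin a × Fin 2) (Fin b × Fin 2) ℝ)]
  congr 1
  ext (e | e) (c | c)
  · exact hr₁.angleForm_coordVector hl h₁ e c
  · exact hr₁.angleForm_coordVector_of_notMem h₁ e (by simp [edgeEquiv_inr])
  · exact hr₂.angleForm_coordVector_of_notMem h₂ e (by simp [edgeEquiv_inl])
  · exact hr₂.angleForm_coordVector hr h₂ e c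

/-- The splitting of a configuration of points indexed by a disjoint union. -/
noncomputable def splitEquiv : (Fin n → ℂ) ≃ᵐ (Fin a → ℂ) × (Fin b → ℂ) :=
  (MeasurableEquiv.piCongrLeft (fun _ => ℂ) σ).symm.trans
    (MeasurableEquiv.sumPiEquivProdPi fun _ => ℂ)

lemma measurePreserving_splitEquiv : MeasurePreserving (splitEquiv σ) :=
  (volume_measurePreserving_piCongrLeft (fun _ => ℂ) σ).symm.trans
    (volume_measurePreserving_sumPiEquivProdPi fun _ => ℂ)

lemma measurableSet_configSpace (n : ℕ) : MeasurableSet (configSpace n) :=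
  have hpos : Measurable fun z : Fin n → ℂ => ∀ k, 0 < (z k).im := .forall fun k =>
    measurableSet_setOfPred.1 <|
      measurableSet_lt measurable_const (Complex.measurable_im.comp (measurable_pi_apply k))
  have hinj : Measurable fun z : Fin n → ℂ => ∀ k l, z k = z l → k = l :=
    .forall fun k => .forall fun l =>
      have heq : Measurable fun z : Fin n → ℂ => z k = z l := measurableSet_setOfPred.1 <|
        measurableSet_eq_fun (measurable_pi_apply k) (measurable_pi_apply l)
      heq.imp measurable_const
  measurableSet_setOfPred.2 (hpos.and hinj)

lemma configSpace_ae_eq_preimage_splitEquiv :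
    configSpace n =ᵐ[volume] splitEquiv σ ⁻¹' (configSpace a ×ˢ configSpace b) := by
  refine Filter.eventuallyEq_set.2 ?_
  filter_upwards [ae_injective (volume : Measure (Fin n → ℂ))] with z hz
  constructor
  · intro h
    exact ⟨⟨fun k => h.1 _, hz.comp (σ.injective.comp Sum.inl_injective)⟩,
      ⟨fun k => h.1 _, hz.comp (σ.injective.comp Sum.inr_injective)⟩⟩
  · rintro ⟨h₁, h₂⟩
    exact ⟨σ.surjective.forall.2 (Sum.forall.2 ⟨h₁.1, h₂.1⟩), hz⟩

lemma setIntegral_weightDensity_glue (Γ₁ : KGraph a 2) (Γ₂ : KGraph b 2) :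
    ∫ z in configSpace n, (glue σ Γ₁ Γ₂).weightDensity z =
      (∫ z in configSpace a, Γ₁.weightDensity z) * ∫ z in configSpace b, Γ₂.weightDensity z := by
  have hmeas : MeasurableSet (configSpace a ×ˢ configSpace b) :=
    (measurableSet_configSpace a).prod (measurableSet_configSpace b)
  calc
    _ = ∫ z in splitEquiv σ ⁻¹' (configSpace a ×ˢ configSpace b),
          (glue σ Γ₁ Γ₂).weightDensity z :=
      setIntegral_congr_set (configSpace_ae_eq_preimage_splitEquiv σ)
    _ = ∫ z in splitEquiv σ ⁻¹' (configSpace a ×ˢ configSpace b),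
          Γ₁.weightDensity (splitEquiv σ z).1 * Γ₂.weightDensity (splitEquiv σ z).2 :=
      setIntegral_congr_fun ((splitEquiv σ).measurable hmeas) fun z hz =>
        weightDensity_glue σ Γ₁ Γ₂ hz.1 hz.2
    _ = ∫ p in configSpace a ×ˢ configSpace b, Γ₁.weightDensity p.1 * Γ₂.weightDensity p.2 :=
      (measurePreserving_splitEquiv σ).setIntegral_preimage_emb (splitEquiv σ).measurableEmbedding
        (fun p => Γ₁.weightDensity p.1 * Γ₂.weightDensity p.2) _
    _ = _ := setIntegral_prod_mul _ _ _ _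

theorem weight_glue (Γ₁ : KGraph a 2) (Γ₂ : KGraph b 2) :
    (glue σ Γ₁ Γ₂).weight = Γ₁.weight * Γ₂.weight := by
  have hn : n = a + b := by simpa using (Fintype.card_congr σ).symm
  rw [weight, weight, weight, setIntegral_weightDensity_glue, hn, mul_add, pow_add]
  ring

lemma weight_zero (Γ : KGraph 0 2) : Γ.weight = 1 := by
  have huniv : configSpace 0 = Set.univ :=
    Set.eq_univ_of_forall fun z => ⟨fun k => k.elim0, Function.injective_of_subsingleton z⟩
  simp [weight, huniv, weightDensity, Measure.volume_pi_eq_dirac (default : Fin 0 → ℂ)]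

end KGraph

/-! ### Connected components -/

namespace KGraph

variable {a b n m : ℕ}

/-- The aerial graph of a disjoint union is the disjoint union of the aerial graphs. -/
def glueIso (σ : Fin a ⊕ Fin b ≃ Fin n) (Γ₁ : KGraph a m) (Γ₂ : KGraph b m) :
    Γ₁.aerialGraph ⊕g Γ₂.aerialGraph ≃g (glue σ Γ₁ Γ₂).aerialGraph where
  toEquiv := σ
  map_rel_iff' {v w} := by
    have hl : ∀ j i, (glue σ Γ₁ Γ₂).1 (σ (Sum.inl j)) i = _ := glue_restrictsTo_inl σ Γ₁ Γ₂
    have hr : ∀ j i, (glue σ Γ₁ Γ₂).1 (σ (Sum.inr j)) i = _ := glue_restrictsTo_inr σ Γ₁ Γ₂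
    rcases v with v | v <;> rcases w with w | w <;>
      simp [aerialGraph, hl, hr, sumMap_eq_inl_iff]

lemma glue_reachable_inl {σ : Fin a ⊕ Fin b ≃ Fin n} {Γ₁ : KGraph a m} {Γ₂ : KGraph b m}
    {j : Fin a} {y : Fin a ⊕ Fin b} :
    (glue σ Γ₁ Γ₂).aerialGraph.Reachable (σ (Sum.inl j)) (σ y) ↔
      ∃ k, y = Sum.inl k ∧ Γ₁.aerialGraph.Reachable j k :=
  (glueIso σ Γ₁ Γ₂).reachable_iff.trans reachable_sum_inl_iff

open Classical in
/-- The set of aerial vertices in the connected component of `v`. -/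
noncomputable def component (Γ : KGraph n m) (v : Fin n) : Finset (Fin n) :=
  Finset.univ.filter (Γ.aerialGraph.Reachable v)

lemma mem_component {Γ : KGraph n m} {v y : Fin n} :
    y ∈ Γ.component v ↔ Γ.aerialGraph.Reachable v y := by
  simp [component]

lemma self_mem_component (Γ : KGraph n m) (v : Fin n) : v ∈ Γ.component v :=
  mem_component.2 (SimpleGraph.Reachable.refl v)

variable {σ : Fin a ⊕ Fin b ≃ Fin n} {S : Finset (Fin n)}

lemma component_eq_iff (hS : Set.range (σ ∘ Sum.inl) = S) {j : Fin a} {Γ : KGraph n m} :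
    Γ.component (σ (Sum.inl j)) = S ↔ ∃ Γ₁ Γ₂, Γ₁.IsConnected ∧ Γ = glue σ Γ₁ Γ₂ := by
  have hmem : ∀ y, σ y ∈ S ↔ ∃ k, y = Sum.inl k := fun y => by
    rw [← Finset.mem_coe, ← hS]
    simp [eq_comm]
  constructor
  · intro hc
    have hreach : ∀ {y}, Γ.aerialGraph.Reachable (σ (Sum.inl j)) (σ y) ↔ ∃ k, y = Sum.inl k :=
      fun {y} => by rw [← mem_component, hc, hmem]
    obtain ⟨Γ₁, Γ₂, rfl⟩ := exists_eq_glue (σ := σ) (Γ := Γ) fun k l hadj => by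
      simpa using hreach.1 ((hreach.2 ⟨k, rfl⟩).trans hadj.reachable)
    have hj : ∀ k, Γ₁.aerialGraph.Reachable j k := fun k => by
      simpa using glue_reachable_inl.1 (hreach.2 ⟨k, rfl⟩)
    have : Nonempty (Fin a) := ⟨j⟩
    exact ⟨Γ₁, Γ₂, ⟨fun k l => (hj k).symm.trans (hj l)⟩, rfl⟩
  · rintro ⟨Γ₁, Γ₂, hΓ₁, rfl⟩
    refine Finset.ext <| σ.surjective.forall.2 fun y => ?_
    rw [mem_component, hmem, glue_reachable_inl]
    exact exists_congr fun k => and_iff_left (hΓ₁.preconnected j k)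

open Classical in
lemma sum_component_eq {M : Type*} [AddCommMonoid M] (f : KGraph n m → M)
    (hS : Set.range (σ ∘ Sum.inl) = S) {v : Fin n} (hv : v ∈ S) :
    ∑ Γ with Γ.component v = S, f Γ =
      ∑ Γ₁ : KGraph a m with Γ₁.IsConnected, ∑ Γ₂ : KGraph b m, f (glue σ Γ₁ Γ₂) := by
  obtain ⟨j, rfl⟩ : v ∈ Set.range (σ ∘ Sum.inl) := hS ▸ Finset.mem_coe.2 hv
  have himage : Finset.univ.filter (fun Γ : KGraph n m => Γ.component (σ (Sum.inl j)) = S) =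
      (Finset.univ.filter (fun Γ₁ : KGraph a m => Γ₁.IsConnected) ×ˢ Finset.univ).image
        fun p : KGraph a m × KGraph b m => glue σ p.1 p.2 := by
    ext Γ
    simp [component_eq_iff hS, eq_comm]
  have hinj : Function.Injective fun p : KGraph a m × KGraph b m => glue σ p.1 p.2 :=
    fun p q h => Prod.ext_iff.2 (glue_inj.1 h)
  rw [Function.comp_apply, himage, Finset.sum_image hinj.injOn, Finset.sum_product]

end KGraph

open KGraph

section GraphSums

variable {d : ℕ} (α : PoissonStructure d) (x : Fin d → ℝ)

/-- The sum of the weighted symbols of all graphs of type `(n, 2)`: `n!` times the symbol of the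
coefficient of `h^n` in the star product. -/
noncomputable def graphSum (n : ℕ) : MvPolynomial (PVar d) ℝ :=
  ∑ Γ : KGraph n 2, Γ.weight • Γ.symbol α x

open Classical in
/-- The sum of the weighted symbols of the connected graphs of type `(n, 2)`: `n!` times the
coefficient of `h^n` in the exponent `(1/h) D(h p_1, h p_2, x)`. -/
noncomputable def connectedSum (n : ℕ) : MvPolynomial (PVar d) ℝ :=
  ∑ Γ : KGraph n 2 with Γ.IsConnected, Γ.weight • Γ.symbol α x

open Classical in
lemma sum_component_weight_symbol {n : ℕ} {S : Finset (Fin n)} {v : Fin n} (hv : v ∈ S) :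
    ∑ Γ : KGraph n 2 with Γ.component v = S, Γ.weight • Γ.symbol α x =
      connectedSum α x S.card * graphSum α x (n - S.card) := by
  have hc : Sᶜ.card = n - S.card := by rw [Finset.card_compl, Fintype.card_fin]
  have hS : Set.range (finSumEquivOfFinset rfl hc ∘ Sum.inl) = S := by
    simpa only [funext fun j => finSumEquivOfFinset_inl rfl hc j, Function.comp_def] using
      Finset.range_orderEmbOfFin S rfl
  rw [sum_component_eq _ hS hv]
  simp only [connectedSum, graphSum, weight_glue, symbol_glue, Finset.sum_mul_sum,
    smul_mul_smul_comm]

theorem graphSum_succ (n : ℕ) :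
    graphSum α x (n + 1) = ∑ p ∈ Finset.HasAntidiagonal.antidiagonal n,
      n.choose p.1 • (connectedSum α x (p.1 + 1) * graphSum α x p.2) := by
  classical
  have huniv : (Finset.univ : Finset (Fin (n + 1))) = insert 0 (Finset.univ.erase 0) := by simp
  calc
    _ = ∑ S : Finset (Fin (n + 1)), ∑ Γ : KGraph (n + 1) 2 with Γ.component 0 = S,
          Γ.weight • Γ.symbol α x :=
      (Finset.sum_fiberwise Finset.univ (fun Γ : KGraph (n + 1) 2 => Γ.component 0) _).symm
    _ = ∑ S : Finset (Fin (n + 1)) with 0 ∈ S,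
          connectedSum α x S.card * graphSum α x (n + 1 - S.card) := by
      rw [Finset.sum_filter]
      refine Finset.sum_congr rfl fun S _ => ?_
      split_ifs with h0
      · exact sum_component_weight_symbol α x h0
      · exact Finset.sum_eq_zero fun Γ hΓ =>
          (h0 ((Finset.mem_filter.1 hΓ).2 ▸ Γ.self_mem_component 0)).elim
    _ = ∑ k ∈ Finset.range (n + 1),
          n.choose k • (connectedSum α x (k + 1) * graphSum α x (n - k)) := by
      rw [← Finset.powerset_univ, huniv, sum_powerset_insert_mem_card (Finset.notMem_erase 0 _)
        fun k => connectedSum α x k * graphSum α x (n + 1 - k)]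
      simp
    _ = _ := (Finset.Nat.sum_antidiagonal_eq_sum_range_succ_mk (fun p : ℕ × ℕ =>
      n.choose p.1 • (connectedSum α x (p.1 + 1) * graphSum α x p.2)) n).symm

lemma graphSum_zero : graphSum α x 0 = 1 := by
  let Γ₀ : KGraph 0 2 := ⟨fun k => k.elim0, fun k => k.elim0, fun k => k.elim0⟩
  rw [graphSum, Fintype.sum_eq_single Γ₀ fun Γ hΓ =>
    (hΓ (Subtype.ext (Subsingleton.elim _ _))).elim, weight_zero, symbol_zero, one_smul]

lemma connectedSum_zero : connectedSum α x 0 = 0 :=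
  Finset.sum_eq_zero fun Γ hΓ => by
    classical
    obtain ⟨k⟩ := (Finset.mem_filter.1 hΓ).2.nonempty
    exact k.elim0

theorem expGenFun_graphSum :
    expGenFun ℝ (graphSum α x) = expSeries (expGenFun ℝ (connectedSum α x)) :=
  expGenFun_eq_subst_exp ℝ (connectedSum_zero α x) (graphSum_zero α x) (graphSum_succ α x)

end GraphSums

/-! ### Loops and trees -/

namespace KGraph

variable {n m : ℕ} {Γ : KGraph n m}

lemma out_injective (Γ : KGraph n m) (k : Fin n) : Function.Injective (Γ.1 k) := by
  simp [Function.Injective, Fin.forall_fin_two, Γ.2.2 k, (Γ.2.2 k).symm]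

/-- The set of edges landing at aerial vertices. -/
def aerialEdges (Γ : KGraph n m) : Finset (Fin n × Fin 2) :=
  Finset.univ.filter fun e => (Γ.target e).isLeft

/-- The unordered pair of endpoints of an edge landing at an aerial vertex. An edge landing at a
ground vertex gets the diagonal pair of its source as a junk value. -/
def endpoints (Γ : KGraph n m) (e : Fin n × Fin 2) : Sym2 (Fin n) :=
  s(e.1, (Γ.target e).elim id fun _ => e.1)

lemma mem_aerialEdges {k : Fin n} {i : Fin 2} :
    (k, i) ∈ Γ.aerialEdges ↔ ∃ l, Γ.1 k i = Sum.inl l := by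
  simp [aerialEdges, target, Sum.isLeft_iff]

lemma endpoints_eq {k l : Fin n} {i : Fin 2} (h : Γ.1 k i = Sum.inl l) :
    Γ.endpoints (k, i) = s(k, l) := by
  rw [endpoints, target, h, Sum.elim_inl, id]

lemma loops_eq (Γ : KGraph n m) : Γ.loops = (Γ.aerialEdges.card : ℤ) - n + 1 := by
  have hcard : Γ.aerialEdges.card + Γ.groundEdges = n * 2 := by
    have hsplit := Finset.card_filter_add_card_filter_not
      (s := (Finset.univ : Finset (Fin n × Fin 2))) fun e => (Γ.target e).isLeft = true
    simpa [aerialEdges, groundEdges] using hsplit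
  unfold loops
  omega

lemma edgeSet_aerialGraph (Γ : KGraph n m) :
    Γ.aerialGraph.edgeSet = Γ.aerialEdges.image Γ.endpoints := by
  refine Set.ext <| Sym2.ind fun k l => ?_
  rw [SimpleGraph.mem_edgeSet, Finset.mem_coe, Finset.mem_image]
  constructor
  · rintro ⟨_, ⟨i, hi⟩ | ⟨i, hi⟩⟩
    · exact ⟨(k, i), mem_aerialEdges.2 ⟨l, hi⟩, endpoints_eq hi⟩
    · exact ⟨(l, i), mem_aerialEdges.2 ⟨k, hi⟩, (endpoints_eq hi).trans Sym2.eq_swap⟩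
  · rintro ⟨⟨k', i⟩, he, hp⟩
    obtain ⟨l', hl'⟩ := mem_aerialEdges.1 he
    have hadj : Γ.aerialGraph.Adj k' l' :=
      ⟨fun h => Γ.2.1 k' i (h ▸ hl'), Or.inl ⟨i, hl'⟩⟩
    rwa [← SimpleGraph.mem_edgeSet, ← hp, endpoints_eq hl', SimpleGraph.mem_edgeSet]

lemma injOn_endpoints_iff :
    Set.InjOn Γ.endpoints Γ.aerialEdges ↔
      ∀ k l, ¬ ((∃ i, Γ.1 k i = Sum.inl l) ∧ ∃ i, Γ.1 l i = Sum.inl k) := by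
  constructor
  · rintro hinj k l ⟨⟨i, hi⟩, i', hi'⟩
    have heq : (k, i) = (l, i') := hinj (mem_aerialEdges.2 ⟨l, hi⟩) (mem_aerialEdges.2 ⟨k, hi'⟩) <|
      (endpoints_eq hi).trans <| Sym2.eq_swap.trans (endpoints_eq hi').symm
    exact Γ.2.1 k i (by rw [hi, (Prod.mk.inj heq).1])
  · rintro hopp ⟨k, i⟩ he ⟨k', i'⟩ he' heq
    obtain ⟨l, hl⟩ := mem_aerialEdges.1 he
    obtain ⟨l', hl'⟩ := mem_aerialEdges.1 he'
    rw [endpoints_eq hl, endpoints_eq hl', Sym2.eq_iff] at heq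
    rcases heq with ⟨hk, rfl⟩ | ⟨hk, rfl⟩
    · obtain rfl : k = k' := hk
      exact congrArg (Prod.mk k) (Γ.out_injective k (hl.trans hl'.symm))
    · obtain rfl : k = l' := hk
      exact (hopp _ _ ⟨⟨i, hl⟩, i', hl'⟩).elim

lemma card_edgeSet_eq (Γ : KGraph n m) :
    Nat.card Γ.aerialGraph.edgeSet = (Γ.aerialEdges.image Γ.endpoints).card := by
  rw [edgeSet_aerialGraph, Nat.card_coe_set_eq, Set.ncard_coe_finset]

lemma card_edgeSet_le (Γ : KGraph n m) :
    Nat.card Γ.aerialGraph.edgeSet ≤ Γ.aerialEdges.card :=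
  Γ.card_edgeSet_eq.trans_le Finset.card_image_le

lemma card_edgeSet_eq_iff :
    Nat.card Γ.aerialGraph.edgeSet = Γ.aerialEdges.card ↔
      ∀ k l, ¬ ((∃ i, Γ.1 k i = Sum.inl l) ∧ ∃ i, Γ.1 l i = Sum.inl k) := by
  rw [card_edgeSet_eq, Finset.card_image_iff, injOn_endpoints_iff]

lemma IsConnected.pos (h : Γ.IsConnected) : 1 ≤ n := by
  obtain ⟨k⟩ := h.nonempty
  exact k.pos

lemma IsConnected.le_card_edgeSet_add_one (h : Γ.IsConnected) :
    n ≤ Nat.card Γ.aerialGraph.edgeSet + 1 := by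
  simpa using SimpleGraph.Connected.card_vert_le_card_edgeSet_add_one h

lemma IsConnected.loops_nonneg (h : Γ.IsConnected) : 0 ≤ Γ.loops := by
  have hn := h.le_card_edgeSet_add_one
  have hle := Γ.card_edgeSet_le
  rw [loops_eq]
  omega

theorem isTree_iff : Γ.IsTree ↔ Γ.IsConnected ∧ Γ.loops = 0 := by
  rw [IsTree, SimpleGraph.isTree_iff_connected_and_card, ← card_edgeSet_eq_iff, Nat.card_fin,
    loops_eq, and_assoc]
  refine and_congr_right fun hconn => ?_
  have hn := IsConnected.le_card_edgeSet_add_one hconn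
  have hle := Γ.card_edgeSet_le
  omega

end KGraph

lemma mem_loopGraphs {n j : ℕ} {Γ : KGraph n 2} :
    (⟨n, Γ⟩ : Σ n : ℕ, KGraph n 2) ∈ loopGraphs j ↔ Γ.IsConnected ∧ Γ.loops = j :=
  ⟨fun h => h.2, fun h => ⟨h.1.pos, h⟩⟩

lemma mem_loopGraphs_zero_iff_isTree {n : ℕ} {Γ : KGraph n 2} :
    (⟨n, Γ⟩ : Σ n : ℕ, KGraph n 2) ∈ loopGraphs 0 ↔ Γ.IsTree := by
  rw [mem_loopGraphs, isTree_iff, Nat.cast_zero]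

/-! ### The exponent -/

lemma KGraph.groundEdges_eq_degree {d n m : ℕ} {α : PoissonStructure d} {x : Fin d → ℝ}
    {Γ : KGraph n m} {β : Fin m × Fin d →₀ ℕ} (h : MvPolynomial.coeff β (Γ.symbol α x) ≠ 0) :
    Γ.groundEdges = β.degree := by
  rw [← Γ.symbol_isHomogeneous α x h, Finsupp.degree_eq_weight_one]
  rfl

section Exponent

variable {d : ℕ} (α : PoissonStructure d) (x : Fin d → ℝ)

open Classical in
/-- The sum of the weighted symbols of the connected graphs of type `(n, 2)` with `j` loops. -/
noncomputable def loopSum (j n : ℕ) : MvPolynomial (PVar d) ℝ :=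
  ∑ Γ : KGraph n 2 with Γ.IsConnected ∧ Γ.loops = (j : ℤ), Γ.weight • Γ.symbol α x

lemma loopSum_isHomogeneous {j k n : ℕ} (h : j + k = n + 1) :
    (loopSum α x j n).IsHomogeneous k := by
  classical
  refine MvPolynomial.IsHomogeneous.sum _ _ _ fun Γ hΓ => ?_
  have hloops := (Finset.mem_filter.1 hΓ).2.2
  obtain rfl : Γ.groundEdges = k := by
    unfold loops at hloops
    omega
  rw [MvPolynomial.smul_eq_C_mul]
  exact (Γ.symbol_isHomogeneous α x).C_mul _

lemma coeff_loopSeries {j n : ℕ} {β : PVar d →₀ ℕ} (h : j + β.degree = n + 1) :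
    MvPowerSeries.coeff β (loopSeries α x j) =
      1 / (n.factorial : ℝ) * MvPolynomial.coeff β (loopSum α x j n) := by
  classical
  let t : Finset (Σ n : ℕ, KGraph n 2) :=
    (Finset.univ.filter fun Γ : KGraph n 2 => Γ.IsConnected ∧ Γ.loops = (j : ℤ)).map
      (Function.Embedding.sigmaMk n)
  have hsum : MvPowerSeries.coeff β (loopSeries α x j) = ∑ Γ ∈ t,
      Γ.2.weight / (Γ.1.factorial : ℝ) * MvPolynomial.coeff β (Γ.2.symbol α x) := by
    refine finsum_mem_eq_sum_of_inter_support_eq _ <| Set.ext fun ⟨n', Γ⟩ =>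
      and_congr_left fun hΓ => ?_
    have hdeg := groundEdges_eq_degree (right_ne_zero_of_mul hΓ)
    simp only [t, Finset.coe_map, Set.mem_image, Finset.mem_coe, Finset.mem_filter_univ,
      Function.Embedding.sigmaMk_apply]
    constructor
    · intro hmem
      have hloops := (mem_loopGraphs.1 hmem).2
      obtain rfl : n' = n := by
        simp only [loops] at hloops hdeg
        omega
      exact ⟨Γ, mem_loopGraphs.1 hmem, rfl⟩
    · rintro ⟨Γ', hΓ', heq⟩
      exact heq ▸ mem_loopGraphs.2 hΓ'
  rw [hsum, Finset.sum_map, loopSum, MvPolynomial.coeff_sum, Finset.mul_sum]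
  refine Finset.sum_congr rfl fun Γ _ => ?_
  rw [Function.Embedding.sigmaMk_apply, MvPolynomial.coeff_smul, smul_eq_mul]
  ring

lemma homogeneousComponent_loopSeries {j k n : ℕ} (h : j + k = n + 1) :
    MvPolynomial.homogeneousComponent k (MvPowerSeries.truncTotal (k + 1) (loopSeries α x j)) =
      (1 / (n.factorial : ℝ)) • loopSum α x j n := by
  ext β
  rw [MvPolynomial.coeff_homogeneousComponent, MvPolynomial.coeff_smul, smul_eq_mul]
  split_ifs with hβ
  · rw [MvPowerSeries.coeff_truncTotal _ (by omega), coeff_loopSeries α x (hβ ▸ h)]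
  · rw [(loopSum_isHomogeneous α x h).coeff_eq_zero hβ, mul_zero]

lemma homogeneousComponent_zero_loopSeries_zero :
    MvPolynomial.homogeneousComponent 0 (MvPowerSeries.truncTotal 1 (loopSeries α x 0)) = 0 := by
  ext β
  rw [MvPolynomial.coeff_homogeneousComponent, MvPolynomial.coeff_zero]
  split_ifs with hβ
  · rw [MvPowerSeries.coeff_truncTotal _ (by omega)]
    refine finsum_mem_eq_zero_of_forall_eq_zero fun Γ hΓ => ?_
    by_contra hne
    have hdeg := groundEdges_eq_degree (right_ne_zero_of_mul hne)
    have hloops := hΓ.2.2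
    unfold loops at hloops
    omega
  · rfl

lemma connectedSum_eq_sum_loopSum (n : ℕ) :
    connectedSum α x n =
      ∑ p ∈ Finset.HasAntidiagonal.antidiagonal (n + 1), loopSum α x p.1 n := by
  classical
  have hloops : ∀ Γ : KGraph n 2, Γ.IsConnected → (Γ.loops.toNat : ℤ) = Γ.loops :=
    fun Γ hΓ => Int.toNat_of_nonneg hΓ.loops_nonneg
  have hmaps : ∀ Γ ∈ Finset.univ.filter fun Γ : KGraph n 2 => Γ.IsConnected,
      (Γ.loops.toNat, Γ.groundEdges) ∈ Finset.HasAntidiagonal.antidiagonal (n + 1) := by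
    intro Γ hΓ
    have hl := hloops Γ (Finset.mem_filter.1 hΓ).2
    rw [Finset.HasAntidiagonal.mem_antidiagonal]
    have hdef : Γ.loops = n - Γ.groundEdges + 1 := rfl
    omega
  rw [connectedSum, ← Finset.sum_fiberwise_of_maps_to hmaps]
  refine Finset.sum_congr rfl fun p hp => ?_
  rw [loopSum, Finset.filter_filter]
  refine congrArg (Finset.sum · _) <| Finset.filter_congr fun Γ _ => and_congr_right fun hΓ => ?_
  have hl := hloops Γ hΓ
  have hp := Finset.HasAntidiagonal.mem_antidiagonal.1 hp
  have hdef : Γ.loops = n - Γ.groundEdges + 1 := rfl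
  rw [Prod.ext_iff]
  dsimp only
  omega

lemma coeff_zero_hScale_fullSeries : PowerSeries.coeff 0 (hScale (fullSeries α x)) = 0 := by
  rw [hScale, PowerSeries.coeff_mk, Finset.HasAntidiagonal.antidiagonal_zero,
    Finset.sum_singleton, fullSeries, PowerSeries.coeff_mk]
  exact homogeneousComponent_zero_loopSeries_zero α x

lemma coeff_succ_hScale_fullSeries (n : ℕ) :
    PowerSeries.coeff (n + 1) (hScale (fullSeries α x)) =
      (1 / (n.factorial : ℝ)) • connectedSum α x n := by
  rw [hScale, PowerSeries.coeff_mk, connectedSum_eq_sum_loopSum, Finset.smul_sum]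
  refine Finset.sum_congr rfl fun p hp => ?_
  rw [fullSeries, PowerSeries.coeff_mk,
    homogeneousComponent_loopSeries α x (Finset.HasAntidiagonal.mem_antidiagonal.1 hp)]

lemma exponent_eq_expGenFun : exponent α x = expGenFun ℝ (connectedSum α x) := by
  ext1 n
  rw [exponent, divByH, PowerSeries.coeff_mk, coeff_succ_hScale_fullSeries, coeff_expGenFun]

lemma coeff_hScale_C (F : MvPowerSeries (PVar d) ℝ) (n : ℕ) :
    PowerSeries.coeff n (hScale (PowerSeries.C F)) =
      MvPolynomial.homogeneousComponent n (MvPowerSeries.truncTotal (n + 1) F) := by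
  rw [hScale, PowerSeries.coeff_mk, Finset.sum_eq_single (0, n)]
  · simp
  · rintro ⟨j, k⟩ hp hne
    have hj : j ≠ 0 := by
      rintro rfl
      exact hne (by simpa using hp)
    simp [PowerSeries.coeff_C, hj]
  · simp

lemma X_mul_divByH {R : Type*} [Semiring R] {F : PowerSeries R}
    (hF : PowerSeries.coeff 0 F = 0) : PowerSeries.X * divByH F = F := by
  ext n
  cases n with
  | zero => simpa using hF.symm
  | succ n => rw [PowerSeries.coeff_succ_X_mul, divByH, PowerSeries.coeff_mk]

open Classical in
lemma loopSum_zero_eq_sum_isTree (n : ℕ) :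
    loopSum α x 0 n = ∑ Γ : KGraph n 2 with Γ.IsTree, Γ.weight • Γ.symbol α x := by
  simp only [loopSum, isTree_iff, Nat.cast_zero]

lemma coeff_semiclassicalPart (n : ℕ) :
    PowerSeries.coeff n (semiclassicalPart α x) =
      (1 / (n.factorial : ℝ)) • loopSum α x 0 n := by
  rw [semiclassicalPart, divByH, PowerSeries.coeff_mk, coeff_hScale_C,
    homogeneousComponent_loopSeries α x (zero_add _)]

theorem generatingFunction_eq :
    generatingFunction α x =
      PowerSeries.C (trivialGeneratingFunction x) + semiclassicalPart α x := by
  classical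
  ext1 n
  rw [generatingFunction, PowerSeries.coeff_mk, map_add, coeff_semiclassicalPart,
    PowerSeries.coeff_C]
  split_ifs with hn
  · subst hn
    rw [loopSum, Finset.sum_eq_zero fun Γ hΓ => ?_, smul_zero, add_zero]
    exact absurd (Finset.mem_filter.1 hΓ).2.1.pos (by omega)
  · rw [zero_add, loopSum_zero_eq_sum_isTree]

end Exponent

/-! ### The action of symbols on functions -/

lemma multiDeriv_zero {d : ℕ} (f : (Fin d → ℝ) → ℝ) : multiDeriv 0 f = f := by
  simp [multiDeriv]

section SymbolAction

variable {d : ℕ} (f g : (Fin d → ℝ) → ℝ) (x : Fin d → ℝ)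

/-- The linear map `Q ↦ Q(∂_{x'}, ∂_{x''}) f(x') g(x'') |_{x' = x'' = x}`. -/
noncomputable def symbolAction : MvPolynomial (PVar d) ℝ →ₗ[ℝ] ℝ :=
  (MvPolynomial.basisMonomials (PVar d) ℝ).constr ℝ fun β =>
    multiDeriv (fun i => β (0, i)) f x * multiDeriv (fun i => β (1, i)) g x

lemma applySymbol_eq_symbolAction (Q : MvPolynomial (PVar d) ℝ) :
    applySymbol Q f g x = symbolAction f g x Q :=
  ((MvPolynomial.basisMonomials (PVar d) ℝ).constr_apply ℝ _ Q).symm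

lemma symbolAction_C_mul_prod (c : ℝ) (β : Fin 2 → Fin d → ℕ) :
    symbolAction f g x (MvPolynomial.C c * ∏ a, ∏ i, MvPolynomial.X (a, i) ^ β a i) =
      c * ∏ a, multiDeriv (β a) (![f, g] a) x := by
  have hmonomial : MvPolynomial.C c * ∏ a, ∏ i, MvPolynomial.X (a, i) ^ β a i =
      c • MvPolynomial.basisMonomials (PVar d) ℝ
        (Finsupp.equivFunOnFinite.symm fun q : PVar d => β q.1 q.2) := by
    rw [MvPolynomial.coe_basisMonomials, MvPolynomial.smul_monomial, smul_eq_mul,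
      mul_one, MvPolynomial.monomial_eq, Finsupp.prod_fintype _ _ (by simp),
      Fintype.prod_prod_type]
    rfl
  rw [hmonomial, map_smul, symbolAction, Module.Basis.constr_basis]
  simp

lemma symbolAction_symbol {n : ℕ} (α : PoissonStructure d) (Γ : KGraph n 2) :
    symbolAction f g x (Γ.symbol α x) = Γ.B α ![f, g] x := by
  rw [symbol, map_sum]
  simp only [symbolAction_C_mul_prod, B]

lemma symbolAction_one : symbolAction f g x 1 = f x * g x := by
  simpa [← Pi.zero_def, multiDeriv_zero] using symbolAction_C_mul_prod f g x 1 0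

lemma coeff_star_apply (α : PoissonStructure d) (n : ℕ) :
    PowerSeries.coeff n (star α f g) x =
      applySymbol ((1 / (n.factorial : ℝ)) • graphSum α x n) f g x := by
  rw [applySymbol_eq_symbolAction, map_smul, star, PowerSeries.coeff_mk]
  split_ifs with hn
  · subst hn
    simp [graphSum_zero, symbolAction_one]
  · simp [graphSum, symbolAction_symbol]

end SymbolAction

theorem map_eval_star {d : ℕ} (α : PoissonStructure d) (f g : (Fin d → ℝ) → ℝ) (x : Fin d → ℝ) :
    PowerSeries.map (Pi.evalRingHom (fun _ : Fin d → ℝ => ℝ) x) (star α f g) =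
      applySeries (expSeries (exponent α x)) f g x := by
  ext n
  rw [PowerSeries.coeff_map, Pi.evalRingHom_apply, coeff_star_apply, applySeries,
    PowerSeries.coeff_mk, exponent_eq_expGenFun, ← expGenFun_graphSum, coeff_expGenFun]

end StarProduct

theorem mainTheorem7 {d : ℕ} (α : StarProduct.PoissonStructure d) (x : Fin d → ℝ) :
    -- `(1/h) D(h p_1, h p_2, x)` is a well-defined power series in `h` without constant term
    (PowerSeries.X * StarProduct.exponent α x =
        StarProduct.hScale (StarProduct.fullSeries α x) ∧
      PowerSeries.constantCoeff (StarProduct.exponent α x) = 0) ∧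
    -- the exponential formula
    (∀ f g : (Fin d → ℝ) → ℝ, ContDiff ℝ ∞ f → ContDiff ℝ ∞ g →
      PowerSeries.map (Pi.evalRingHom (fun _ : Fin d → ℝ => ℝ) x) (StarProduct.star α f g) =
        StarProduct.applySeries (StarProduct.expSeries (StarProduct.exponent α x)) f g x) ∧
    -- `D^0` is the tree part
    (∀ (n : ℕ) (Γ : StarProduct.KGraph n 2),
      (⟨n, Γ⟩ : Σ n : ℕ, StarProduct.KGraph n 2) ∈ StarProduct.loopGraphs 0 ↔ Γ.IsTree) ∧
    -- the semi-classical part `(1/h) D^0(h p_1, h p_2, x)` gives the generating function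
    PowerSeries.X * StarProduct.semiclassicalPart α x =
      StarProduct.hScale (PowerSeries.C (StarProduct.loopSeries α x 0)) ∧
    StarProduct.generatingFunction α x =
      PowerSeries.C (StarProduct.trivialGeneratingFunction x) +
        StarProduct.semiclassicalPart α x := by
  refine ⟨⟨StarProduct.X_mul_divByH (StarProduct.coeff_zero_hScale_fullSeries α x), ?_⟩,
    fun f g _ _ => StarProduct.map_eval_star α f g x,
    fun n Γ => StarProduct.mem_loopGraphs_zero_iff_isTree,
    StarProduct.X_mul_divByH ?_, StarProduct.generatingFunction_eq α x⟩
  · rw [StarProduct.exponent_eq_expGenFun, StarProduct.constantCoeff_expGenFun,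
      StarProduct.connectedSum_zero]
  · rw [StarProduct.coeff_hScale_C, StarProduct.homogeneousComponent_zero_loopSeries_zero]
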